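/- Let $\mathbb D$ be the open unit disk in $\mathbb C$ and let $H^2$ be the Hardy space of the bidisk $\mathbb D^2$: the Hilbert space of holomorphic functions $\sum_{n,m\ge 0}a_{n,m}z_1^nz_2^m$ on $\mathbb D^2$ with $\sum_{n,m}|a_{n,m}|^2<\infty$, normed by $\bigl(\sum_{n,m}|a_{n,m}|^2\bigr)^{1/2}$. Let $$k_\lambda(z)=\frac{1}{(1-\overline{\lambda_1}z_1)(1-\overline{\lambda_2}z_2)}\qquad(z,\lambda\in\mathbb D^2)$$ be its reproducing kernel and let $\mathcal D\subset H^2$ be the linear span of $\{k_\lambda:\lambda\in\mathbb D^2\}$. For a holomorphic function $f$ on $\mathbb D^2$, let $T_f$ be the (possibly unbounded) Toeplitz operator of multiplication by $f$ with domain $\mathcal D$; its adjoint acts on $\mathcal D$ as the linear map $T_f^*:\mathcal D\to\mathcal D$ with $T_f^*k_\lambda=\overline{f(\lambda)}\,k_\lambda$ for $\lambda\in\mathbb D^2$, and $\langle T_fT_f^*x,x\rangle=\|T_f^*x\|^2$ for $x\in\mathcal D$ (for $f\notin H^2$, this map $T_f^*$ and this quadratic form are taken as definitions). The Schur--Drury--Agler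 class $\mathcal S(\mathbb D^2;2,1)$ is the set of triples $(\varphi_1,\varphi_2,\varphi_3)$ of holomorphic (not necessarily bounded) functions on $\mathbb D^2$ such that $$0\le T_{\varphi_1}T_{\varphi_1}^*+T_{\varphi_2}T_{\varphi_2}^*-T_{\varphi_3}T_{\varphi_3}^*\le I\quad\text{on }\mathcal D,$$ that is, $0\le\|T_{\varphi_1}^*x\|^2+\|T_{\varphi_2}^*x\|^2-\|T_{\varphi_3}^*x\|^2\le\|x\|^2$ for all $x\in\mathcal D$. **Proposition.** Let $(\varphi_1,\varphi_2,\varphi_3)\in\mathcal S(\mathbb D^2;2,1)$ with $\varphi_1(0,0)=\varphi_2(0,0)=0$. Then for every $z=(z_1,z_2)\in\mathbb D^2$, $$0\le|\varphi_1(z)|^2+|\varphi_2(z)|^2-|\varphi_3(z)|^2\le|z_1|^2+|z_2|^2-|z_1z_2|^2 .$$ -/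

import Mathlib

noncomputable section

open scoped ComplexConjugate InnerProductSpace

/-- The open unit bidisk `𝔻²` in `ℂ²`. -/
def bidisk : Set (ℂ × ℂ) := {z | ‖z.1‖ < 1 ∧ ‖z.2‖ < 1}

/-- The Hardy space `H²` of the bidisk: the holomorphic functions `∑ a (n, m) z₁ⁿ z₂ᵐ` with square
summable Taylor coefficients, each recorded by its family of Taylor coefficients. The inner
product of Mathlib is conjugate linear in its first argument. -/
abbrev HardyBidisk : Type := lp (fun _ : ℕ × ℕ => ℂ) 2

/-- The value at `z` of the function with Taylor coefficients `a`. -/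
def HardyBidisk.eval (a : HardyBidisk) (z : ℂ × ℂ) : ℂ :=
  ∑' i : ℕ × ℕ, a i * (z.1 ^ i.1 * z.2 ^ i.2)

theorem szego_memlp (w : bidisk) :
    Memℓp (fun i : ℕ × ℕ => (conj w.1.1 ^ i.1 * conj w.1.2 ^ i.2 : ℂ)) 2 := by
  obtain ⟨⟨w1, w2⟩, h1, h2⟩ := w
  have key : ∀ x : ℂ, ‖x‖ < 1 → Summable fun n : ℕ => (‖x‖ ^ 2) ^ n := fun x hx =>
    summable_geometric_of_lt_one (by positivity) (by nlinarith [norm_nonneg x])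
  refine memℓp_gen ?_
  refine ((key w1 h1).mul_of_nonneg (key w2 h2) (fun _ => by positivity)
    (fun _ => by positivity)).congr fun i => ?_
  simp only [ENNReal.toReal_ofNat, Real.rpow_ofNat, norm_mul, norm_pow, RCLike.norm_conj]
  ring

/-- The reproducing kernel `k_w(z) = 1 / ((1 - conj w₁ z₁) (1 - conj w₂ z₂))` of `H²`, whose
Taylor coefficients are `conj w₁ⁿ conj w₂ᵐ`. -/
def szego (w : bidisk) : HardyBidisk :=
  ⟨fun i => conj w.1.1 ^ i.1 * conj w.1.2 ^ i.2, szego_memlp w⟩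

theorem szego_eval (w z : bidisk) :
    (szego w).eval z = 1 / ((1 - conj w.1.1 * z.1.1) * (1 - conj w.1.2 * z.1.2)) := by
  obtain ⟨⟨w1, w2⟩, h1, h2⟩ := w
  obtain ⟨⟨z1, z2⟩, h3, h4⟩ := z
  simp only at h1 h2 h3 h4
  have key : ∀ x y : ℂ, ‖x‖ < 1 → ‖y‖ < 1 → ‖conj x * y‖ < 1 := fun x y hx hy => by
    rw [norm_mul, RCLike.norm_conj]
    nlinarith [norm_nonneg x, norm_nonneg y]
  have e := tsum_mul_tsum_of_summable_norm
    (summable_norm_geometric_of_norm_lt_one (key w1 z1 h1 h3))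
    (summable_norm_geometric_of_norm_lt_one (key w2 z2 h2 h4))
  rw [tsum_geometric_of_norm_lt_one (key w1 z1 h1 h3),
    tsum_geometric_of_norm_lt_one (key w2 z2 h2 h4)] at e
  rw [one_div, mul_inv, e, HardyBidisk.eval]
  refine tsum_congr fun i => ?_
  simp only [szego, mul_pow]
  ring

/-- The reproducing property. -/
theorem inner_szego (w : bidisk) (a : HardyBidisk) : ⟪szego w, a⟫_ℂ = a.eval w := by
  rw [lp.inner_eq_tsum, HardyBidisk.eval]
  refine tsum_congr fun i => ?_
  simp [szego, RCLike.inner_apply]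

theorem szego_linearIndependent : LinearIndependent ℂ szego := by
  let χ : bidisk → (Multiplicative (ℕ × ℕ) →* ℂ) := fun w =>
    { toFun := fun i => conj w.1.1 ^ i.toAdd.1 * conj w.1.2 ^ i.toAdd.2
      map_one' := by simp
      map_mul' := fun i j => by simp only [toAdd_mul, Prod.fst_add, Prod.snd_add, pow_add]; ring }
  have hχ : Function.Injective χ := fun v w h => by
    have h1 := DFunLike.congr_fun h (Multiplicative.ofAdd ((1, 0) : ℕ × ℕ))
    have h2 := DFunLike.congr_fun h (Multiplicative.ofAdd ((0, 1) : ℕ × ℕ))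
    simp only [χ, MonoidHom.coe_mk, OneHom.coe_mk, toAdd_ofAdd, pow_one, pow_zero, mul_one,
      one_mul] at h1 h2
    exact Subtype.ext (Prod.ext (star_injective h1) (star_injective h2))
  let L : HardyBidisk →ₗ[ℂ] (Multiplicative (ℕ × ℕ) → ℂ) :=
    { toFun := fun a i => a i.toAdd
      map_add' := fun _ _ => rfl
      map_smul' := fun _ _ => rfl }
  exact LinearIndependent.of_comp L
    ((linearIndependent_monoidHom (Multiplicative (ℕ × ℕ)) ℂ).comp χ hχ)

/-- The space `𝒟` of finite linear combinations of the reproducing kernels. -/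
def kernelSpan : Submodule ℂ HardyBidisk := Submodule.span ℂ (Set.range szego)

/-- The reproducing kernels form an algebraic basis of `𝒟`. -/
def szegoBasis : Module.Basis bidisk ℂ kernelSpan := Module.Basis.span szego_linearIndependent

/-- The adjoint `T_f*` on `𝒟` of the Toeplitz operator `T_f` (multiplication by `f`, with
domain `𝒟`): the linear map with `T_f* k_w = conj (f w) k_w`. It is the adjoint of
multiplication by `f` by `inner_toeplitzAdj` below. -/
def toeplitzAdj (f : ℂ × ℂ → ℂ) : kernelSpan →ₗ[ℂ] kernelSpan :=
  szegoBasis.constr ℂ fun w => conj (f w) • szegoBasis w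

theorem coe_szegoBasis (w : bidisk) : (szegoBasis w : HardyBidisk) = szego w :=
  congrArg Subtype.val (Module.Basis.span_apply szego_linearIndependent w)

theorem toeplitzAdj_szego (f : ℂ × ℂ → ℂ) (w : bidisk) :
    toeplitzAdj f (szegoBasis w) = conj (f w) • szegoBasis w := by
  simp [toeplitzAdj]

/-- If `g ∈ H²` is the product `f x`, that is `g = T_f x`, then `⟪y, T_f x⟫ = ⟪T_f* y, x⟫`. -/
theorem inner_toeplitzAdj (f : ℂ × ℂ → ℂ) (x g : HardyBidisk)
    (hg : ∀ z ∈ bidisk, g.eval z = f z * x.eval z) (y : kernelSpan) :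
    ⟪(y : HardyBidisk), g⟫_ℂ = ⟪(toeplitzAdj f y : HardyBidisk), x⟫_ℂ := by
  obtain ⟨v, hv⟩ := y
  induction hv using Submodule.span_induction with
  | mem v h =>
    obtain ⟨w, rfl⟩ := h
    have e : (⟨szego w, Submodule.subset_span ⟨w, rfl⟩⟩ : kernelSpan) = szegoBasis w :=
      Subtype.ext (coe_szegoBasis w).symm
    rw [e, toeplitzAdj_szego, Submodule.coe_smul, coe_szegoBasis, inner_smul_left, inner_szego,
      inner_szego, hg w w.2]
    simp
  | zero =>
    have e : (⟨0, zero_mem _⟩ : kernelSpan) = 0 := rfl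
    rw [e]
    simp
  | add u v hu hv ihu ihv =>
    have e : (⟨u + v, add_mem hu hv⟩ : kernelSpan) = ⟨u, hu⟩ + ⟨v, hv⟩ := rfl
    rw [e, map_add, Submodule.coe_add, Submodule.coe_add, inner_add_left, inner_add_left, ihu, ihv]
  | smul c v hv ih =>
    have e : (⟨c • v, Submodule.smul_mem _ c hv⟩ : kernelSpan) = c • ⟨v, hv⟩ := rfl
    rw [e, map_smul, Submodule.coe_smul, Submodule.coe_smul, inner_smul_left, inner_smul_left, ih]

/-- The Schur–Drury–Agler class `𝒮(𝔻²; 2, 1)`: the triples of (possibly unbounded) holomorphic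
functions on `𝔻²` with `0 ≤ T₁ T₁* + T₂ T₂* - T₃ T₃* ≤ I` on `𝒟`, where `Tⱼ = T_{φⱼ}`. An operator
inequality on `𝒟` is one between quadratic forms, and the form of `Tⱼ Tⱼ*` at `x ∈ 𝒟` is
`⟪Tⱼ Tⱼ* x, x⟫ = ‖Tⱼ* x‖²`, the norm being that of `H²`. -/
structure SchurDruryAgler (φ₁ φ₂ φ₃ : ℂ × ℂ → ℂ) : Prop where
  holo₁ : DifferentiableOn ℂ φ₁ bidisk
  holo₂ : DifferentiableOn ℂ φ₂ bidisk
  holo₃ : DifferentiableOn ℂ φ₃ bidisk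
  nonneg : ∀ x : kernelSpan,
    0 ≤ ‖toeplitzAdj φ₁ x‖ ^ 2 + ‖toeplitzAdj φ₂ x‖ ^ 2 - ‖toeplitzAdj φ₃ x‖ ^ 2
  le_one : ∀ x : kernelSpan,
    ‖toeplitzAdj φ₁ x‖ ^ 2 + ‖toeplitzAdj φ₂ x‖ ^ 2 - ‖toeplitzAdj φ₃ x‖ ^ 2 ≤ ‖x‖ ^ 2

end

open scoped ComplexConjugate InnerProductSpace

/-! Each kernel `k_z` is an eigenvector of every `T_f*`, so positivity tested on `k_z` is the lower
bound times `‖k_z‖²`. At the origin it forces `φ₃` to vanish there too, so all three adjoints kill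
`k_0 = 1`. Replacing `k_z` by `k_z - k_0` then leaves the form unchanged but lowers the squared norm
by `1`, and the upper bound becomes `1 - 1 / ‖k_z‖² = 1 - (1 - |z₁|²)(1 - |z₂|²)`. -/

theorem norm_toeplitzAdj_szegoBasis (f : ℂ × ℂ → ℂ) (w : bidisk) :
    ‖toeplitzAdj f (szegoBasis w)‖ ^ 2 = ‖f w‖ ^ 2 * ‖szegoBasis w‖ ^ 2 := by
  rw [toeplitzAdj_szego, norm_smul, RCLike.norm_conj, mul_pow]

theorem norm_toeplitzAdj_szegoBasis_sub (f : ℂ × ℂ → ℂ) (v w : bidisk) (hv : f v = 0) :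
    ‖toeplitzAdj f (szegoBasis w - szegoBasis v)‖ ^ 2 = ‖f w‖ ^ 2 * ‖szegoBasis w‖ ^ 2 := by
  rw [map_sub, toeplitzAdj_szego f v, hv, map_zero, zero_smul, sub_zero,
    norm_toeplitzAdj_szegoBasis]

theorem norm_szegoBasis_sq (w : bidisk) :
    ‖szegoBasis w‖ ^ 2 = 1 / ((1 - ‖w.1.1‖ ^ 2) * (1 - ‖w.1.2‖ ^ 2)) := by
  have h := inner_self_eq_norm_sq_to_K (𝕜 := ℂ) (szego w)
  rw [inner_szego, szego_eval, RCLike.conj_mul, RCLike.conj_mul] at h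
  rw [← coe_szegoBasis, Submodule.norm_coe] at h
  refine Complex.ofReal_injective ?_
  push_cast
  exact h.symm

/-- Pythagoras: `k_0` is the constant `1`, a unit vector, and `⟪k_w, k_0⟫ = 1`, so `k_w - k_0` is
the component of `k_w` orthogonal to `k_0`. -/
theorem norm_szegoBasis_sub_zero_sq (w v : bidisk) (hv : v.1 = (0, 0)) :
    ‖szegoBasis w - szegoBasis v‖ ^ 2 = ‖szegoBasis w‖ ^ 2 - 1 := by
  have hi : ⟪szegoBasis w, szegoBasis v⟫_ℂ = 1 := by
    rw [Submodule.coe_inner, coe_szegoBasis, coe_szegoBasis, inner_szego, szego_eval, hv]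
    simp
  have hn : ‖szegoBasis v‖ ^ 2 = 1 := by rw [norm_szegoBasis_sq, hv]; simp
  rw [norm_sub_sq (𝕜 := ℂ), hi, hn, RCLike.one_re]
  ring

theorem mainTheorem5 (φ₁ φ₂ φ₃ : ℂ × ℂ → ℂ) (hφ : SchurDruryAgler φ₁ φ₂ φ₃)
    (h₁ : φ₁ (0, 0) = 0) (h₂ : φ₂ (0, 0) = 0) (z : ℂ × ℂ) (hz : z ∈ bidisk) :
    0 ≤ ‖φ₁ z‖ ^ 2 + ‖φ₂ z‖ ^ 2 - ‖φ₃ z‖ ^ 2 ∧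
    ‖φ₁ z‖ ^ 2 + ‖φ₂ z‖ ^ 2 - ‖φ₃ z‖ ^ 2 ≤ ‖z.1‖ ^ 2 + ‖z.2‖ ^ 2 - ‖z.1 * z.2‖ ^ 2 := by
  let o : bidisk := ⟨(0, 0), by simp [bidisk]⟩
  let w : bidisk := ⟨z, hz⟩
  -- At `k_0` the two positive terms vanish, so positivity leaves `0 ≤ -|φ₃(0, 0)|²`.
  have h₃ : φ₃ (0, 0) = 0 := by
    have h := hφ.nonneg (szegoBasis o)
    simp only [norm_toeplitzAdj_szegoBasis, norm_szegoBasis_sq, o, h₁, h₂] at h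
    have h' : ‖φ₃ (0, 0)‖ ^ 2 ≤ 0 := by simpa using h
    exact norm_eq_zero.1 (pow_eq_zero_iff two_ne_zero |>.1 (le_antisymm h' (sq_nonneg _)))
  have hp : 0 < (1 - ‖z.1‖ ^ 2) * (1 - ‖z.2‖ ^ 2) :=
    mul_pos (by nlinarith [hz.1, norm_nonneg z.1]) (by nlinarith [hz.2, norm_nonneg z.2])
  have hk : ‖szegoBasis w‖ ^ 2 = 1 / ((1 - ‖z.1‖ ^ 2) * (1 - ‖z.2‖ ^ 2)) := norm_szegoBasis_sq w
  constructor
  · have h := hφ.nonneg (szegoBasis w)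
    simp only [norm_toeplitzAdj_szegoBasis] at h
    rw [← add_mul, ← sub_mul, hk] at h
    exact nonneg_of_mul_nonneg_left h (one_div_pos.2 hp)
  -- Testing on `k_z` alone would only give the bound `1`; subtracting `k_0` gains the Schwarz-type
  -- improvement.
  · have h := hφ.le_one (szegoBasis w - szegoBasis o)
    rw [norm_toeplitzAdj_szegoBasis_sub _ _ _ h₁, norm_toeplitzAdj_szegoBasis_sub _ _ _ h₂,
      norm_toeplitzAdj_szegoBasis_sub _ _ _ h₃, norm_szegoBasis_sub_zero_sq w o rfl,
      ← add_mul, ← sub_mul, hk, mul_one_div, div_le_iff₀ hp, sub_mul, one_div_mul_cancel hp.ne']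
      at h
    rw [norm_mul]
    linarith
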